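/- Let $(S,\mathcal S,Q)$ be a probability space and let $h:S\times\mathbb R\to\mathbb R$ be such that $h(\cdot,t)$ is measurable for every $t\in\mathbb R$, $h(x,\cdot)$ is convex for every $x\in S$, and the right and left derivatives $D^{+}h(x,t)$, $D^{-}h(x,t)$ of $h(x,\cdot)$ at $t$ satisfy $\int_S |D^{\pm}h(x,t)|\,Q(dx)<\infty$ for every $t\in\mathbb R$. Fix $t_0\in\mathbb R$, put $$M(t)=\int_S \big(h(x,t)-h(x,t_0)\big)\,Q(dx),\qquad t\in\mathbb R,$$ and suppose that $m\in\mathbb R$ is the unique minimizing point of $M$. Let $X_1,X_2,\dots$ be i.i.d. $S$-valued random variables with distribution $Q$ on a probability space $(\Omega,\mathcal A,\mathbb P)$, and let $\hat m_n$ be the smallest minimizing point of $$M_n(t)=\frac1n\sum_{i=1}^n \big(h(X_i,t)-h(X_i,t_0)\big)$$ (with $\hat m_n:=\inf A$, where $A$ is the set of minimizing points of $M_n$, and with the convention $\hat m_n:=0$ if $A$ is empty or not bounded below, so that no smallest minimizing point exists). Let $s\ge 2$, and suppose that for some $x_0>0$ $$L_s:=\sup_{|y|\le x_0}\mathbb E\big[|D^{+}h(X_1,m+y)|^s\big]<\infty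 .$$ Then there is a real constant $K_s>0$, of the form $K_s=B_sL_s$ with a constant $B_s>0$ that depends only on $s$, such that the following holds. Let $(a_n)_{n\ge1}$ be any sequence of positive reals with $a_n\to\infty$ and let $\delta:\mathbb R\to[-\infty,\infty]$ be any function such that $$\sqrt n\,D^{+}M(m+x/a_n)\longrightarrow\delta(x)\quad\text{in }[-\infty,\infty]\text{ for all }x\in\mathbb R .$$ Then $$\limsup_{n\to\infty}\mathbb P\Big(a_n\sup_{k\ge n}(\hat m_k-m)>x\Big)\le K_s\,\delta(x)^{-s}\quad\text{for all }x>0,$$ $$\limsup_{n\to\infty}\mathbb P\Big(a_n\inf_{k\ge n}(\hat m_k-m)<x\Big)\le K_s\,(-\delta(x))^{-s}\quad\text{for all }x<0,$$ $$\limsup_{n\to\infty}\mathbb P\Big(a_n\sup_{k\ge n}|\hat m_k-m|>x\Big)\le 2K_s\,\Delta(x)^{-s}\quad\text{for all }x>0,$$ where $\Delta(x)=\min\{\delta(x),-\delta(-x)\}$. Here $\delta(x)$ (for $x>0$), $-\delta(x)$ (for $x<0$) and $\Delta(x)$ are automatically in $[0,\infty]$, and $0^{-s}=\infty$, $\infty^{-s}=0$.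 -/

import Mathlib

open MeasureTheory ProbabilityTheory Filter Set
open scoped Topology ENNReal NNReal

noncomputable section

namespace ConvexMEst

/-- Right derivative `D⁺f(t)`. -/
def dPlus (f : ℝ → ℝ) (t : ℝ) : ℝ := derivWithin f (Ioi t) t

/-- Left derivative `D⁻f(t)`. -/
def dMinus (f : ℝ → ℝ) (t : ℝ) : ℝ := derivWithin f (Iio t) t

/-- The set of all minimizing points of `f`. -/
def minimizers (f : ℝ → ℝ) : Set ℝ := {t | ∀ u, f t ≤ f u}

/-- The criterion function `M(t) = ∫ h(x,t) - h(x,t₀) Q(dx)`. -/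
def criterion {S : Type*} [MeasurableSpace S] (Q : Measure S) (h : S → ℝ → ℝ) (t₀ t : ℝ) : ℝ :=
  ∫ x, (h x t - h x t₀) ∂Q

/-- The empirical criterion function `M_n(t) = n⁻¹ ∑_{i ≤ n} h(X_i,t) - h(X_i,t₀)`; the sample
of size `n` consists of `X 0, …, X (n - 1)`. -/
def empCriterion {Ω S : Type*} (X : ℕ → Ω → S) (h : S → ℝ → ℝ) (t₀ : ℝ) (n : ℕ) (ω : Ω) (t : ℝ) :
    ℝ :=
  (n : ℝ)⁻¹ * ∑ i ∈ Finset.range n, (h (X i ω) t - h (X i ω) t₀)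

/-- The smallest minimizing point of `f`, whenever there is one. -/
def smallestMinimizer (f : ℝ → ℝ) : ℝ := sInf (minimizers f)

theorem smallestMinimizer_eq {f : ℝ → ℝ} {t : ℝ} (ht : IsLeast (minimizers f) t) :
    smallestMinimizer f = t := ht.csInf_eq

/-- The convex M-estimator: the smallest minimizing point of the empirical criterion function. -/
def mEst {Ω S : Type*} (X : ℕ → Ω → S) (h : S → ℝ → ℝ) (t₀ : ℝ) (n : ℕ) (ω : Ω) : ℝ :=
  smallestMinimizer (empCriterion X h t₀ n ω)

/-- `L_s = sup_{|y| ≤ x₀} E |D⁺h(X₁, m + y)|^s`. -/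
def supMoment {Ω S : Type*} [MeasurableSpace Ω] (P : Measure Ω) (X : ℕ → Ω → S) (h : S → ℝ → ℝ)
    (m x₀ s : ℝ) : ℝ≥0∞ :=
  ⨆ y ∈ Icc (-x₀) x₀, ∫⁻ ω, ENNReal.ofReal (|dPlus (h (X 0 ω)) (m + y)| ^ s) ∂P

/-- `(a_n)` is a positive sequence tending to infinity such that
`√n D⁺M(m + x / a_n) → δ(x)` in `[-∞, ∞]` for every real `x`. -/
structure IsNormalizing (M : ℝ → ℝ) (m : ℝ) (a : ℕ → ℝ) (δ : ℝ → EReal) : Prop where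
  pos : ∀ n, 1 ≤ n → 0 < a n
  tendsto_atTop : Tendsto a atTop atTop
  tendsto : ∀ x : ℝ, Tendsto (fun n : ℕ => ((√(n : ℝ) * dPlus M (m + x / a n) : ℝ) : EReal))
    atTop (𝓝 (δ x))

end ConvexMEst

end

open ConvexMEst

universe u v

/-! Convexity turns a deviation of the estimator into a sign condition at a deterministic point:
`m̂_k > t` forces `D⁺M_k(t) < 0`, and `m̂_k < t` forces `D⁺M_k(t) ≥ 0`. At `t = m + x / a_n`
uniqueness of `m` gives `D⁺M(t)` the sign of `x`. So a deviation at some `k ≥ n` makes the centred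
sum of the first `k` variables `D⁺h(X_i, t) - D⁺M(t)` at least `k |D⁺M(t)|` in absolute value.

What remains is a maximal inequality of Hájek–Rényi type, `measure_exists_le_abs_sum_le`: for
independent centred variables with `s`-th moments at most `L`, the probability that `|S_k| ≥ l k`
for some `k ≥ n` is at most `4 C L (√n l) ^ (-s)`. With `l = |D⁺M(t)|`, `√n l` tends to `±δ(x)`. The
inequality comes from a second order expansion of `|a + b| ^ s` whose linear term is annihilated by
independence; `setIntegral_abs_add_rpow_le` applies it on events of the past.

The estimator takes a default value when no smallest minimizer exists. By the strong law at `m - 1`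
and `m + 1`, the probability that this happens at some `k ≥ n` tends to zero
(`tendsto_measure_unlocalized`). -/

/-! ### Expansion of the power function. -/

theorem one_add_rpow_le_quadratic {s t : ℝ} (hs : 2 ≤ s) (ht : |t| ≤ 1 / 2) :
    (1 + t) ^ s ≤ 1 + s * t + s * (s * 2 ^ s) * t ^ 2 := by
  -- The tangent to `u ^ p` at `1 + t`, evaluated at `1`: Bernoulli's inequality at `-t / (1 + t)`.
  have tangent : ∀ p : ℝ, 1 ≤ p → (1 + t) ^ p ≤ 1 + p * t * (1 + t) ^ (p - 1) := by
    intro p hp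
    have h1 : 0 < 1 + t := by linarith [(abs_le.1 ht).1]
    have h2 := one_add_mul_self_le_rpow_one_add (s := -t / (1 + t))
      (by rw [le_div_iff₀ h1]; linarith) hp
    have h3 : 1 + -t / (1 + t) = (1 + t)⁻¹ := by field_simp; ring
    rw [h3, Real.inv_rpow h1.le] at h2
    have h4 : 0 < (1 + t) ^ p := Real.rpow_pos_of_pos h1 _
    have h5 := mul_le_mul_of_nonneg_left h2 h4.le
    rw [mul_inv_cancel₀ h4.ne'] at h5
    have h6 : (1 + t) ^ p = (1 + t) ^ (p - 1) * (1 + t) := by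
      rw [Real.rpow_sub_one h1.ne']; field_simp
    have h7 : (1 + t) ^ p * (1 + p * (-t / (1 + t))) = (1 + t) ^ p - p * t * (1 + t) ^ (p - 1) := by
      rw [h6]; field_simp; ring
    linarith
  obtain ⟨ht1, ht2⟩ := abs_le.1 ht
  have h2s : (1 : ℝ) ≤ 2 ^ s := Real.one_le_rpow one_le_two (by linarith)
  have hst := tangent s (by linarith)
  have key : t * (1 + t) ^ (s - 1) ≤ t + s * 2 ^ s * t ^ 2 := by
    rcases le_total 0 t with h0 | h0
    · have h1 := tangent (s - 1) (by linarith)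
      have h2 : (1 + t) ^ (s - 1 - 1) ≤ 2 ^ s :=
        (Real.rpow_le_rpow (by linarith) (by linarith : 1 + t ≤ 2) (by linarith)).trans
          (Real.rpow_le_rpow_of_exponent_le one_le_two (by linarith))
      have h3 : (s - 1) * t * (1 + t) ^ (s - 1 - 1) ≤ s * t * 2 ^ s :=
        mul_le_mul (by nlinarith) h2 (Real.rpow_nonneg (by linarith) _) (by nlinarith)
      nlinarith
    · have h1 := one_add_mul_self_le_rpow_one_add (by linarith : -1 ≤ t)
        (by linarith : 1 ≤ s - 1)
      have h2 := mul_le_mul_of_nonpos_left h1 h0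
      nlinarith [sq_nonneg t, mul_nonneg (sq_nonneg t) (by nlinarith : 0 ≤ s * 2 ^ s - (s - 1))]
  nlinarith

/-- By homogeneity `a = 1`. Small `b` is covered by the quadratic bound; for `|b| ≥ 1 / 2` every
term is dominated by `b ^ 2` or `|b| ^ s`. -/
theorem exists_abs_add_rpow_le {s : ℝ} (hs : 2 ≤ s) :
    ∃ C : ℝ, 1 ≤ C ∧ ∀ a b : ℝ,
      |a + b| ^ s ≤ |a| ^ s + s * (|a| ^ (s - 2) * a) * b
        + C * (|a| ^ (s - 2) * b ^ 2 + |b| ^ s) := by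
  have h3s : (1 : ℝ) ≤ 3 ^ s := Real.one_le_rpow (by norm_num) (by linarith)
  have h2s : (1 : ℝ) ≤ 2 ^ s := Real.one_le_rpow (by norm_num) (by linarith)
  set C : ℝ := 3 ^ s + 2 * s + s * (s * 2 ^ s) with hC
  have hCa : 0 ≤ s * (s * 2 ^ s) := by positivity
  have hunit : ∀ t : ℝ, |1 + t| ^ s ≤ 1 + s * t + C * (t ^ 2 + |t| ^ s) := by
    intro t
    have hts : 0 ≤ |t| ^ s := by positivity
    rcases le_total |t| (1 / 2) with ht | ht
    · rw [abs_of_pos (by linarith [(abs_le.1 ht).1])]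
      have := one_add_rpow_le_quadratic hs ht
      nlinarith [sq_nonneg t]
    · have h1 : |1 + t| ^ s ≤ 3 ^ s * |t| ^ s := by
        rw [← Real.mul_rpow (by norm_num) (abs_nonneg _)]
        refine Real.rpow_le_rpow (abs_nonneg _) ?_ (by linarith)
        calc |1 + t| ≤ |1| + |t| := abs_add_le _ _
          _ ≤ 3 * |t| := by rw [abs_one]; linarith
      have h2 : -t ≤ 2 * t ^ 2 := by
        rw [← sq_abs t]; nlinarith [neg_abs_le t]
      nlinarith [sq_nonneg t]
  refine ⟨C, by nlinarith, fun a b => ?_⟩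
  rcases eq_or_ne a 0 with rfl | ha
  · have h0 : (0 : ℝ) ^ s = 0 := Real.zero_rpow (by linarith)
    have : 0 ≤ (0 : ℝ) ^ (s - 2) * b ^ 2 := by positivity
    have hb : 0 ≤ |b| ^ s := by positivity
    simp only [zero_add, abs_zero, h0, mul_zero, zero_mul]
    nlinarith
  · have ha' : 0 < |a| := abs_pos.2 ha
    have h1 := mul_le_mul_of_nonneg_left (hunit (b / a)) (Real.rpow_nonneg ha'.le s)
    rw [← Real.mul_rpow ha'.le (abs_nonneg _), ← abs_mul,
      show a * (1 + b / a) = a + b by field_simp] at h1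
    refine h1.trans_eq ?_
    have h2 : |a| ^ s = |a| ^ (s - 2) * a ^ 2 := by
      rw [← sq_abs a, ← Real.rpow_natCast, ← Real.rpow_add ha']; norm_num
    have h3 : |b| ^ s = |a| ^ s * |b / a| ^ s := by
      rw [← Real.mul_rpow ha'.le (abs_nonneg _), ← abs_mul]; congr 2; field_simp
    rw [h3, h2]; field_simp

/-- Second order expansion of `|·| ^ s`, with the quadratic term split by Young's inequality. -/
theorem exists_abs_add_rpow_le_of_one_le {s : ℝ} (hs : 2 ≤ s) :
    ∃ C : ℝ, 1 ≤ C ∧ ∀ r : ℝ, 1 ≤ r → ∀ a b : ℝ,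
      |a + b| ^ s ≤ |a| ^ s + s * (|a| ^ (s - 2) * a) * b + |a| ^ s / (2 * r)
        + C * r ^ (s / 2 - 1) * |b| ^ s := by
  obtain ⟨C, hC1, hC⟩ := exists_abs_add_rpow_le hs
  have hD : 0 ≤ C * (2 * C) ^ (s / 2 - 1) := by positivity
  refine ⟨C + C * (2 * C) ^ (s / 2 - 1), by linarith, fun r hr a b => (hC a b).trans ?_⟩
  have hr1 : 1 ≤ r ^ (s / 2 - 1) := Real.one_le_rpow hr (by linarith)
  have hbs : 0 ≤ |b| ^ s := by positivity
  have has : 0 ≤ |a| ^ s := by positivity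
  have key : C * (|a| ^ (s - 2) * b ^ 2)
      ≤ |a| ^ s / (2 * r) + C * (2 * C) ^ (s / 2 - 1) * r ^ (s / 2 - 1) * |b| ^ s := by
    have pow_split : ∀ x : ℝ, |x| ^ s = |x| ^ (s - 2) * x ^ 2 := by
      intro x
      rw [← sq_abs x, ← Real.rpow_natCast, ← Real.rpow_add_of_nonneg (abs_nonneg _) (by linarith)
        (by norm_num)]
      norm_num
    -- The threshold is where the quadratic term equals `|a| ^ s / (2 * r)`. Beyond it, `|a| ^ (s -
    -- 2)` is bounded by a multiple of `|b| ^ (s - 2)`.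
    rcases le_total (2 * C * r * b ^ 2) (a ^ 2) with h | h
    · have h1 : C * (|a| ^ (s - 2) * b ^ 2) ≤ |a| ^ s / (2 * r) := by
        rw [le_div_iff₀ (by linarith), pow_split a]
        have := mul_le_mul_of_nonneg_left h (Real.rpow_nonneg (abs_nonneg a) (s - 2))
        linarith
      have : 0 ≤ C * (2 * C) ^ (s / 2 - 1) * r ^ (s / 2 - 1) * |b| ^ s := by positivity
      linarith
    · have sq_split : ∀ x : ℝ, |x| ^ (s - 2) = (x ^ 2) ^ (s / 2 - 1) := by
        intro x
        rw [← sq_abs x, ← Real.rpow_natCast, ← Real.rpow_mul (abs_nonneg _)]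
        congr 1; push_cast; ring
      have h1 : |a| ^ (s - 2) ≤ (2 * C) ^ (s / 2 - 1) * r ^ (s / 2 - 1) * |b| ^ (s - 2) := by
        rw [sq_split a, sq_split b, ← Real.mul_rpow (by positivity) (by positivity),
          ← Real.mul_rpow (by positivity) (by positivity)]
        exact Real.rpow_le_rpow (sq_nonneg a) h (by linarith)
      have h2 : |a| ^ (s - 2) * b ^ 2
          ≤ (2 * C) ^ (s / 2 - 1) * r ^ (s / 2 - 1) * |b| ^ (s - 2) * b ^ 2 :=
        mul_le_mul_of_nonneg_right h1 (sq_nonneg b)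
      have h3 := mul_le_mul_of_nonneg_left h2 (by linarith : 0 ≤ C)
      have h4 : 0 ≤ |a| ^ s / (2 * r) := by positivity
      rw [pow_split b]
      linarith
  have h5 : C * |b| ^ s ≤ C * (r ^ (s / 2 - 1) * |b| ^ s) :=
    mul_le_mul_of_nonneg_left (le_mul_of_one_le_left hbs hr1) (by linarith)
  linarith

/-! ### Integrability from `s`-th moments. -/

section Sums

variable {Ω : Type*} {mΩ : MeasurableSpace Ω} {P : Measure Ω} {s : ℝ}

theorem rpow_le_one_add_rpow {x p q : ℝ} (hx : 0 ≤ x) (hp : 0 ≤ p) (hpq : p ≤ q) :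
    x ^ p ≤ 1 + x ^ q := by
  have hq : 0 ≤ x ^ q := by positivity
  rcases le_total x 1 with h | h
  · linarith [Real.rpow_le_one hx h hp]
  · linarith [Real.rpow_le_rpow_of_exponent_le h hpq]

theorem abs_add_rpow_le_two_rpow_mul (hs : 0 ≤ s) (x y : ℝ) :
    |x + y| ^ s ≤ 2 ^ s * (|x| ^ s + |y| ^ s) := by
  have hx : 0 ≤ |x| ^ s := by positivity
  have hy : 0 ≤ |y| ^ s := by positivity
  have key : ∀ z : ℝ, 0 ≤ z → |x + y| ≤ 2 * z → |x + y| ^ s ≤ 2 ^ s * z ^ s := fun z hz h => by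
    rw [← Real.mul_rpow zero_le_two hz]
    exact Real.rpow_le_rpow (abs_nonneg _) h hs
  have h2 : (0 : ℝ) ≤ 2 ^ s := by positivity
  have := abs_add_le x y
  rcases le_total |x| |y| with h | h
  · exact (key _ (abs_nonneg y) (by linarith)).trans
      (mul_le_mul_of_nonneg_left (by linarith) h2)
  · exact (key _ (abs_nonneg x) (by linarith)).trans
      (mul_le_mul_of_nonneg_left (by linarith) h2)

theorem integrable_abs_add_rpow {f g : Ω → ℝ} (hs : 1 ≤ s) (hf : Measurable f) (hg : Measurable g)
    (hfs : Integrable (fun ω => |f ω| ^ s) P) (hgs : Integrable (fun ω => |g ω| ^ s) P) :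
    Integrable (fun ω => |f ω + g ω| ^ s) P := by
  refine ((hfs.add hgs).const_mul (2 ^ s)).mono'
    ((hf.add hg).abs.pow_const s).aestronglyMeasurable (ae_of_all _ fun ω => ?_)
  rw [Real.norm_of_nonneg (by positivity)]
  exact abs_add_rpow_le_two_rpow_mul (by linarith) _ _

theorem integrable_of_abs_rpow [IsProbabilityMeasure P] {f : Ω → ℝ} (hs : 1 ≤ s) (hf : Measurable f)
    (hfs : Integrable (fun ω => |f ω| ^ s) P) : Integrable f P := by
  refine ((integrable_const 1).add hfs).mono' hf.aestronglyMeasurable (ae_of_all _ fun ω => ?_)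
  simpa using rpow_le_one_add_rpow (abs_nonneg (f ω)) zero_le_one hs

end Sums

/-- The linear term has factor `1_B |T| ^ (s - 2) T`, which is `F`-measurable, hence independent of
the centred `Y`, and its integral vanishes. The two error terms are enlarged to the whole space,
where moment bounds are available. -/
theorem setIntegral_abs_add_rpow_le {Ω : Type*} {F mΩ : MeasurableSpace Ω} {P : Measure Ω}
    [IsProbabilityMeasure P] {s C r : ℝ} (hs : 2 ≤ s)
    (hC : ∀ a b : ℝ, |a + b| ^ s ≤ |a| ^ s + s * (|a| ^ (s - 2) * a) * b + |a| ^ s / (2 * r)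
        + C * r ^ (s / 2 - 1) * |b| ^ s)
    (hC0 : 0 ≤ C) (hr : 0 < r) (hF : F ≤ mΩ) {T Y : Ω → ℝ}
    (hT : Measurable[F] T) (hY : Measurable Y)
    (hind : Indep F (MeasurableSpace.comap Y inferInstance) P)
    (hTs : Integrable (fun ω => |T ω| ^ s) P) (hYs : Integrable (fun ω => |Y ω| ^ s) P)
    (hY0 : ∫ ω, Y ω ∂P = 0) {B : Set Ω} (hB : MeasurableSet[F] B) :
    ∫ ω in B, |T ω + Y ω| ^ s ∂P ≤ ∫ ω in B, |T ω| ^ s ∂P + (∫ ω, |T ω| ^ s ∂P) / (2 * r)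
      + C * r ^ (s / 2 - 1) * ∫ ω, |Y ω| ^ s ∂P := by
  have hT' : Measurable T := hT.mono hF le_rfl
  have hBm : MeasurableSet B := hF _ hB
  set Z : Ω → ℝ := B.indicator fun ω => |T ω| ^ (s - 2) * T ω with hZ
  have hZF : Measurable[F] Z := by
    refine Measurable.indicator ?_ hB
    exact ((measurable_id.abs.pow_const (s - 2)).mul measurable_id).comp hT
  have hTi : Integrable (fun ω => |T ω| ^ (s - 2) * T ω) P := by
    refine ((integrable_const 1).add hTs).mono' ((hT'.abs.pow_const _).mul hT').aestronglyMeasurable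
      (ae_of_all _ fun ω => ?_)
    rw [norm_mul, Real.norm_of_nonneg (by positivity), Real.norm_eq_abs]
    have : |T ω| ^ (s - 2) * |T ω| = |T ω| ^ (s - 1) := by
      nth_rw 2 [← Real.rpow_one |T ω|]
      rw [← Real.rpow_add_of_nonneg (abs_nonneg _) (by linarith) zero_le_one]
      congr 1; ring
    rw [this]
    exact rpow_le_one_add_rpow (abs_nonneg _) (by linarith) (by linarith)
  have hZi : Integrable Z P := hTi.indicator hBm
  have hYi : Integrable Y P := integrable_of_abs_rpow (by linarith) hY hYs
  have hZY : IndepFun Z Y P := by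
    rw [IndepFun_iff_Indep]
    exact indep_of_indep_of_le_left hind hZF.comap_le
  have hprod : Integrable (fun ω => Z ω * Y ω) P := hZY.integrable_mul hZi hYi
  have hzero : ∫ ω, Z ω * Y ω ∂P = 0 := by
    rw [hZY.integral_fun_mul_eq_mul_integral hZi.1 hYi.1, hY0, mul_zero]
  have hTB : Integrable (B.indicator fun ω => |T ω| ^ s) P := hTs.indicator hBm
  have hbound : ∫ ω, B.indicator (fun ω => |T ω + Y ω| ^ s) ω ∂P
      ≤ ∫ ω, (B.indicator (fun ω => |T ω| ^ s) ω + s * (Z ω * Y ω) + |T ω| ^ s / (2 * r)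
        + C * r ^ (s / 2 - 1) * |Y ω| ^ s) ∂P := by
    refine integral_mono
      ((integrable_abs_add_rpow (by linarith : 1 ≤ s) hT' hY hTs hYs).indicator hBm)
      (by exact ((hTB.add (hprod.const_mul s)).add (hTs.div_const _)).add (hYs.const_mul _))
      (fun ω => ?_)
    by_cases hω : ω ∈ B
    · simp only [hZ, indicator_of_mem hω]
      exact (hC _ _).trans_eq (by ring)
    · simp only [hZ, indicator_of_notMem hω]
      have : 0 ≤ |T ω| ^ s / (2 * r) + C * r ^ (s / 2 - 1) * |Y ω| ^ s := by positivity
      linarith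
  rw [integral_add (by exact (hTB.add (hprod.const_mul s)).add (hTs.div_const _))
      (hYs.const_mul _),
    integral_add (by exact hTB.add (hprod.const_mul s)) (hTs.div_const _),
    integral_add hTB (hprod.const_mul s), integral_const_mul, integral_const_mul,
    integral_div, hzero, mul_zero, add_zero, integral_indicator hBm, integral_indicator hBm]
    at hbound
  exact hbound

/-! ### Moment and maximal inequalities for partial sums. -/

section Sums

variable {Ω : Type*} {mΩ : MeasurableSpace Ω} {P : Measure Ω} {s : ℝ}

/-- The σ-algebra generated by the first `k` members of a sequence of random variables. -/
abbrev pastSigma (Y : ℕ → Ω → ℝ) (k : ℕ) : MeasurableSpace Ω :=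
  ⨆ i ∈ Iio k, MeasurableSpace.comap (Y i) inferInstance

theorem pastSigma_le {Y : ℕ → Ω → ℝ} (hY : ∀ i, Measurable (Y i)) (k : ℕ) :
    pastSigma Y k ≤ mΩ := iSup₂_le fun i _ => (hY i).comap_le

theorem pastSigma_mono (Y : ℕ → Ω → ℝ) : Monotone (pastSigma Y) := fun _ _ hkl =>
  biSup_mono fun _ hi => lt_of_lt_of_le hi hkl

theorem measurable_sum_pastSigma (Y : ℕ → Ω → ℝ) (k : ℕ) :
    Measurable[pastSigma Y k] fun ω => ∑ i ∈ Finset.range k, Y i ω := by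
  refine Finset.measurable_fun_sum _ fun i hi => ?_
  exact measurable_iff_comap_le.2
    (le_biSup (fun i => MeasurableSpace.comap (Y i) inferInstance) (Finset.mem_range.1 hi))

theorem indep_pastSigma {Y : ℕ → Ω → ℝ} (hY : ∀ i, Measurable (Y i)) (hind : iIndepFun Y P)
    (k : ℕ) : Indep (pastSigma Y k) (MeasurableSpace.comap (Y k) inferInstance) P := by
  have := indep_iSup_of_disjoint (fun i => (hY i).comap_le)
    ((iIndepFun_iff_iIndep _ _ _).1 hind) (S := Iio k) (T := {k}) (by simp)
  simpa [pastSigma] using this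

theorem integrable_abs_sum_rpow {Y : ℕ → Ω → ℝ} (hs : 1 ≤ s) (hY : ∀ i, Measurable (Y i))
    (hYs : ∀ i, Integrable (fun ω => |Y i ω| ^ s) P) (k : ℕ) :
    Integrable (fun ω => |∑ i ∈ Finset.range k, Y i ω| ^ s) P := by
  induction k with
  | zero => simp [Real.zero_rpow (by linarith : s ≠ 0)]
  | succ k ih =>
    simp only [Finset.sum_range_succ]
    exact integrable_abs_add_rpow hs (by fun_prop) (hY k) ih (hYs k)

variable [IsProbabilityMeasure P] {Y : ℕ → Ω → ℝ} {C L : ℝ}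

/-- Marcinkiewicz–Zygmund type moment bound for sums of independent centred variables. -/
theorem integral_abs_sum_rpow_le (hs : 2 ≤ s) (hC1 : 1 ≤ C)
    (hC : ∀ r : ℝ, 1 ≤ r → ∀ a b : ℝ,
      |a + b| ^ s ≤ |a| ^ s + s * (|a| ^ (s - 2) * a) * b + |a| ^ s / (2 * r)
        + C * r ^ (s / 2 - 1) * |b| ^ s)
    (hY : ∀ i, Measurable (Y i)) (hind : iIndepFun Y P)
    (hYs : ∀ i, Integrable (fun ω => |Y i ω| ^ s) P) (hY0 : ∀ i, ∫ ω, Y i ω ∂P = 0)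
    (hL : ∀ i, ∫ ω, |Y i ω| ^ s ∂P ≤ L) {k : ℕ} (hk : 1 ≤ k) :
    ∫ ω, |∑ i ∈ Finset.range k, Y i ω| ^ s ∂P ≤ 2 * C * L * (k : ℝ) ^ (s / 2) := by
  have hL0 : 0 ≤ L := (integral_nonneg fun ω => by positivity).trans (hL 0)
  induction k, hk using Nat.le_induction with
  | base => simpa using (hL 0).trans (by nlinarith)
  | succ k hk ih =>
    have hk1 : (1 : ℝ) ≤ k := by exact_mod_cast hk
    have hk0 : (0 : ℝ) < k := by linarith
    have h1 := setIntegral_abs_add_rpow_le hs (hC k hk1) (by linarith) hk0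
      (pastSigma_le hY k) (measurable_sum_pastSigma Y k) (hY k) (indep_pastSigma hY hind k)
      (integrable_abs_sum_rpow (by linarith) hY hYs k) (hYs k) (hY0 k) MeasurableSet.univ
    simp only [setIntegral_univ] at h1
    simp only [Finset.sum_range_succ]
    have hkp : (k : ℝ) ^ (s / 2) = (k : ℝ) ^ (s / 2 - 1) * k := by
      rw [Real.rpow_sub_one hk0.ne']; field_simp
    -- Taking `r = k` makes both error terms at most `C * L * k ^ (s / 2 - 1)`, matching the growth
    -- of `k ^ (s / 2)` over one step.
    have h2 : (∫ ω, |∑ i ∈ Finset.range k, Y i ω| ^ s ∂P) / (2 * k)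
        ≤ C * L * (k : ℝ) ^ (s / 2 - 1) := by
      rw [div_le_iff₀ (by positivity)]
      rw [hkp] at ih
      linarith
    have h3 : C * (k : ℝ) ^ (s / 2 - 1) * ∫ ω, |Y k ω| ^ s ∂P
        ≤ C * (k : ℝ) ^ (s / 2 - 1) * L := mul_le_mul_of_nonneg_left (hL k) (by positivity)
    have h4 : (k : ℝ) ^ (s / 2) + (k : ℝ) ^ (s / 2 - 1) ≤ ((k + 1 : ℕ) : ℝ) ^ (s / 2) := by
      have h5 := one_add_mul_self_le_rpow_one_add (s := (k : ℝ)⁻¹)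
        (by linarith [inv_pos.2 hk0]) (p := s / 2) (by linarith)
      have h6 : ((k + 1 : ℕ) : ℝ) = k * (1 + (k : ℝ)⁻¹) := by push_cast; field_simp
      rw [h6, Real.mul_rpow hk0.le (by positivity)]
      have h7 : 1 + (k : ℝ)⁻¹ ≤ (1 + (k : ℝ)⁻¹) ^ (s / 2) :=
        le_trans (by nlinarith [inv_pos.2 hk0]) h5
      refine le_trans (le_of_eq ?_) (mul_le_mul_of_nonneg_left h7 (by positivity))
      rw [hkp]; field_simp
    have h8 := mul_le_mul_of_nonneg_left h4 (by positivity : 0 ≤ 2 * C * L)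
    linarith

/-- Closes the induction for the maximal inequality: the growth of the moments from `k` to `k + 1`
is paid for by the decrease of `k ^ (-(s / 2))`. Both reduce to `(1 + 1 / k) ^ (s / 2) ≥ 1 + 1 / k`.
-/
theorem rpow_telescope_le {k : ℝ} (hs : 2 ≤ s) (hk : 0 < k) :
    (k + 1) ^ (-s) * k ^ (s / 2 - 1) + (k + 1) ^ (-(s / 2)) ≤ k ^ (-(s / 2)) := by
  have hk1 : 0 < k + 1 := by linarith
  have h5 := one_add_mul_self_le_rpow_one_add (s := k⁻¹)
    (by linarith [inv_pos.2 hk]) (p := s / 2) (by linarith)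
  have h7 : 1 + k⁻¹ ≤ (1 + k⁻¹) ^ (s / 2) :=
    le_trans (by nlinarith [inv_pos.2 hk]) h5
  have h1 : k ^ (-(s / 2)) = (k + 1) ^ (-(s / 2)) * (1 + k⁻¹) ^ (s / 2) := by
    rw [show 1 + k⁻¹ = (k + 1) / k by field_simp, Real.div_rpow hk1.le hk.le, Real.rpow_neg hk.le,
      Real.rpow_neg hk1.le]
    have := Real.rpow_pos_of_pos hk1 (s / 2)
    field_simp
  have h2 : (k + 1) ^ (-s) * k ^ (s / 2 - 1) ≤ (k + 1) ^ (-(s / 2)) * k⁻¹ := by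
    rw [Real.rpow_sub_one hk.ne', div_eq_mul_inv, ← mul_assoc]
    refine mul_le_mul_of_nonneg_right ?_ (by positivity)
    calc (k + 1) ^ (-s) * k ^ (s / 2) ≤ (k + 1) ^ (-s) * (k + 1) ^ (s / 2) :=
          mul_le_mul_of_nonneg_left (Real.rpow_le_rpow hk.le (by linarith) (by linarith))
            (by positivity)
      _ = (k + 1) ^ (-(s / 2)) := by rw [← Real.rpow_add hk1]; congr 1; ring
  have h3 := mul_le_mul_of_nonneg_left h7 (Real.rpow_nonneg hk1.le (-(s / 2)))
  rw [h1]
  linarith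

/-- Induction on the horizon, with the starting time and the past event `B` left free. Where the
threshold is crossed at time `k`, Markov's inequality applies. The rest of `B` still belongs to the
past at time `k + 1`, so the induction hypothesis applies there and the expansion brings the moment
back to time `k`. -/
theorem measureReal_inter_exists_le (hs : 2 ≤ s) (hC1 : 1 ≤ C)
    (hC : ∀ r : ℝ, 1 ≤ r → ∀ a b : ℝ,
      |a + b| ^ s ≤ |a| ^ s + s * (|a| ^ (s - 2) * a) * b + |a| ^ s / (2 * r)
        + C * r ^ (s / 2 - 1) * |b| ^ s)
    (hY : ∀ i, Measurable (Y i)) (hind : iIndepFun Y P)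
    (hYs : ∀ i, Integrable (fun ω => |Y i ω| ^ s) P) (hY0 : ∀ i, ∫ ω, Y i ω ∂P = 0)
    (hL : ∀ i, ∫ ω, |Y i ω| ^ s ∂P ≤ L) {l : ℝ} (hl : 0 < l) (N : ℕ) {k : ℕ} (hk : 1 ≤ k)
    {B : Set Ω} (hB : MeasurableSet[pastSigma Y k] B) :
    l ^ s * P.real (B ∩ {ω | ∃ j, k ≤ j ∧ j < k + N ∧ l * j ≤ |∑ i ∈ Finset.range j, Y i ω|})
      ≤ (k : ℝ) ^ (-s) * ∫ ω in B, |∑ i ∈ Finset.range k, Y i ω| ^ s ∂P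
        + 2 * C * L * (k : ℝ) ^ (-(s / 2)) := by
  have hL0 : 0 ≤ L := (integral_nonneg fun ω => by positivity).trans (hL 0)
  have hI : ∀ (k : ℕ) (B : Set Ω), 0 ≤ ∫ ω in B, |∑ i ∈ Finset.range k, Y i ω| ^ s ∂P :=
    fun k B => integral_nonneg fun ω => by positivity
  induction N generalizing k B with
  | zero =>
    have : {ω | ∃ j, k ≤ j ∧ j < k + 0 ∧ l * j ≤ |∑ i ∈ Finset.range j, Y i ω|} = ∅ := by
      ext ω; simp only [mem_ofPred_eq, mem_empty_iff_false, iff_false]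
      rintro ⟨j, h1, h2, -⟩; omega
    rw [this, inter_empty, measureReal_empty, mul_zero]
    have := hI k B
    positivity
  | succ N ih =>
    have hk0 : (0 : ℝ) < k := by exact_mod_cast hk
    have hSi := integrable_abs_sum_rpow (by linarith : 1 ≤ s) hY hYs k
    set A : Set Ω := {ω | l * k ≤ |∑ i ∈ Finset.range k, Y i ω|} with hA
    have hAF : MeasurableSet[pastSigma Y k] A :=
      (measurable_sum_pastSigma Y k) (measurableSet_le measurable_const measurable_id.abs :
        MeasurableSet {x : ℝ | l * k ≤ |x|})
    have hB1 : MeasurableSet[pastSigma Y k] (B ∩ A) := hB.inter hAF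
    have hB2 : MeasurableSet[pastSigma Y k] (B \ A) := hB.diff hAF
    have hle := pastSigma_le hY k
    have hsub : B ∩ {ω | ∃ j, k ≤ j ∧ j < k + (N + 1) ∧ l * j ≤ |∑ i ∈ Finset.range j, Y i ω|}
        ⊆ (B ∩ A) ∪ ((B \ A) ∩ {ω | ∃ j, k + 1 ≤ j ∧ j < k + 1 + N ∧
          l * j ≤ |∑ i ∈ Finset.range j, Y i ω|}) := by
      rintro ω ⟨hωB, j, hj1, hj2, hj3⟩
      by_cases hωA : ω ∈ A
      · exact Or.inl ⟨hωB, hωA⟩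
      · refine Or.inr ⟨⟨hωB, hωA⟩, j, ?_, by omega, hj3⟩
        rcases hj1.eq_or_lt with rfl | h
        · exact absurd hj3 hωA
        · exact h
    have h1 := ih (k := k + 1) (by omega) (pastSigma_mono Y (Nat.le_succ k) _ hB2)
    have hmarkov : l ^ s * P.real (B ∩ A)
        ≤ (k : ℝ) ^ (-s) * ∫ ω in B ∩ A, |∑ i ∈ Finset.range k, Y i ω| ^ s ∂P := by
      rw [Real.rpow_neg hk0.le, inv_mul_eq_div, le_div_iff₀ (by positivity)]
      have : ∫ ω in B ∩ A, (l * k) ^ s ∂P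
          ≤ ∫ ω in B ∩ A, |∑ i ∈ Finset.range k, Y i ω| ^ s ∂P := by
        refine setIntegral_mono_on (integrable_const _).integrableOn hSi.integrableOn (hle _ hB1)
          fun ω hω => Real.rpow_le_rpow (by positivity) hω.2 (by linarith)
      rw [setIntegral_const, smul_eq_mul, Real.mul_rpow hl.le hk0.le] at this
      linarith
    have hstep := setIntegral_abs_add_rpow_le hs (hC k (by exact_mod_cast hk)) (by linarith) hk0
      hle (measurable_sum_pastSigma Y k) (hY k) (indep_pastSigma hY hind k)
      hSi (hYs k) (hY0 k) hB2
    have hmom := integral_abs_sum_rpow_le hs hC1 hC hY hind hYs hY0 hL hk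
    have hstep2 : ∫ ω in B \ A, |∑ i ∈ Finset.range (k + 1), Y i ω| ^ s ∂P
        ≤ ∫ ω in B \ A, |∑ i ∈ Finset.range k, Y i ω| ^ s ∂P
          + 2 * C * L * (k : ℝ) ^ (s / 2 - 1) := by
      simp only [Finset.sum_range_succ]
      have h2 : (∫ ω, |∑ i ∈ Finset.range k, Y i ω| ^ s ∂P) / (2 * k)
          ≤ C * L * (k : ℝ) ^ (s / 2 - 1) := by
        rw [div_le_iff₀ (by positivity)]
        rw [show (k : ℝ) ^ (s / 2) = (k : ℝ) ^ (s / 2 - 1) * k by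
          rw [Real.rpow_sub_one hk0.ne']; field_simp] at hmom
        linarith
      have h3 : C * (k : ℝ) ^ (s / 2 - 1) * ∫ ω, |Y k ω| ^ s ∂P
          ≤ C * (k : ℝ) ^ (s / 2 - 1) * L := mul_le_mul_of_nonneg_left (hL k) (by positivity)
      linarith
    have htel := rpow_telescope_le hs hk0
    have hsplit : ∫ ω in B, |∑ i ∈ Finset.range k, Y i ω| ^ s ∂P
        = ∫ ω in B ∩ A, |∑ i ∈ Finset.range k, Y i ω| ^ s ∂P
          + ∫ ω in B \ A, |∑ i ∈ Finset.range k, Y i ω| ^ s ∂P :=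
      (integral_inter_add_sdiff (hle _ hAF) hSi.integrableOn).symm
    have hunion : l ^ s * P.real
        (B ∩ {ω | ∃ j, k ≤ j ∧ j < k + (N + 1) ∧ l * j ≤ |∑ i ∈ Finset.range j, Y i ω|})
        ≤ l ^ s * P.real (B ∩ A) + l ^ s * P.real ((B \ A) ∩ {ω | ∃ j, k + 1 ≤ j ∧
          j < k + 1 + N ∧ l * j ≤ |∑ i ∈ Finset.range j, Y i ω|}) := by
      rw [← mul_add]
      exact mul_le_mul_of_nonneg_left ((measureReal_mono hsub).trans (measureReal_union_le _ _))
        (by positivity)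
    push_cast at h1
    have hanti : ((k : ℝ) + 1) ^ (-s) ≤ (k : ℝ) ^ (-s) :=
      -- On `B \ A` the weight increases from `(k + 1) ^ (-s)` to `k ^ (-s)`, so that both pieces of
      -- `B` carry the same weight.
      Real.rpow_le_rpow_of_nonpos hk0 (by linarith) (by linarith)
    have h4 := mul_le_mul_of_nonneg_left hstep2
      (by positivity : 0 ≤ ((k : ℝ) + 1) ^ (-s))
    have h5 := mul_le_mul_of_nonneg_right hanti (hI k (B \ A))
    have h6 := mul_le_mul_of_nonneg_left htel (by positivity : 0 ≤ 2 * C * L)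
    rw [hsplit]
    linarith

/-- Maximal inequality for the tail of the sequence of sample means. -/
theorem measure_exists_le_abs_sum_le (hs : 2 ≤ s) (hC1 : 1 ≤ C)
    (hC : ∀ r : ℝ, 1 ≤ r → ∀ a b : ℝ,
      |a + b| ^ s ≤ |a| ^ s + s * (|a| ^ (s - 2) * a) * b + |a| ^ s / (2 * r)
        + C * r ^ (s / 2 - 1) * |b| ^ s)
    (hY : ∀ i, Measurable (Y i)) (hind : iIndepFun Y P)
    (hYs : ∀ i, Integrable (fun ω => |Y i ω| ^ s) P) (hY0 : ∀ i, ∫ ω, Y i ω ∂P = 0)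
    (hL : ∀ i, ∫ ω, |Y i ω| ^ s ∂P ≤ L) {l : ℝ} (hl : 0 < l) {k : ℕ} (hk : 1 ≤ k) :
    P {ω | ∃ j, k ≤ j ∧ l * j ≤ |∑ i ∈ Finset.range j, Y i ω|}
      ≤ ENNReal.ofReal (4 * C * L * (√k * l) ^ (-s)) := by
  have hk0 : (0 : ℝ) < k := by exact_mod_cast hk
  have hset : {ω | ∃ j, k ≤ j ∧ l * j ≤ |∑ i ∈ Finset.range j, Y i ω|}
      = ⋃ N : ℕ, {ω | ∃ j, k ≤ j ∧ j < k + N ∧ l * j ≤ |∑ i ∈ Finset.range j, Y i ω|} := by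
    ext ω
    simp only [mem_ofPred_eq, mem_iUnion]
    constructor
    · rintro ⟨j, h1, h2⟩; exact ⟨j + 1, j, h1, by omega, h2⟩
    · rintro ⟨N, j, h1, -, h2⟩; exact ⟨j, h1, h2⟩
  have hmono : Monotone fun N : ℕ =>
      {ω | ∃ j, k ≤ j ∧ j < k + N ∧ l * j ≤ |∑ i ∈ Finset.range j, Y i ω|} := by
    rintro N N' hN ω ⟨j, h1, h2, h3⟩
    exact ⟨j, h1, by omega, h3⟩
  rw [hset, hmono.measure_iUnion]
  refine iSup_le fun N => ?_
  rw [← ofReal_measureReal]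
  refine ENNReal.ofReal_le_ofReal ?_
  have h1 := measureReal_inter_exists_le hs hC1 hC hY hind hYs hY0 hL hl N hk MeasurableSet.univ
  have h2 := integral_abs_sum_rpow_le hs hC1 hC hY hind hYs hY0 hL hk
  rw [univ_inter, setIntegral_univ] at h1
  have h3 := mul_le_mul_of_nonneg_left h2 (by positivity : 0 ≤ (k : ℝ) ^ (-s))
  have h4 : (k : ℝ) ^ (-s) * (2 * C * L * (k : ℝ) ^ (s / 2))
      = 2 * C * L * (k : ℝ) ^ (-(s / 2)) := by
    rw [mul_left_comm, ← Real.rpow_add hk0]; congr 2; ring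
  have h5 : (√k * l) ^ (-s) = (k : ℝ) ^ (-(s / 2)) * (l ^ s)⁻¹ := by
    rw [Real.mul_rpow (Real.sqrt_nonneg _) hl.le, Real.rpow_neg hl.le, Real.sqrt_eq_rpow,
      ← Real.rpow_mul hk0.le]
    congr 2; ring
  rw [h5, ← mul_assoc, ← div_eq_mul_inv, le_div_iff₀ (by positivity)]
  linarith

end Sums

/-! ### Right derivatives and minimizers of convex functions. -/

section Convex

variable {f : ℝ → ℝ} {t u : ℝ}

theorem hasDerivWithinAt_dPlus (hf : ConvexOn ℝ univ f) (t : ℝ) :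
    HasDerivWithinAt f (dPlus f t) (Ioi t) t :=
  hf.hasDerivWithinAt_rightDeriv_of_mem_interior (by simp)

theorem dPlus_eq_of_hasDerivWithinAt {c : ℝ} (h : HasDerivWithinAt f c (Ioi t) t) :
    dPlus f t = c := h.derivWithin (uniqueDiffWithinAt_Ioi t)

theorem monotone_dPlus (hf : ConvexOn ℝ univ f) : Monotone (dPlus f) := by
  have := hf.monotoneOn_rightDeriv
  rw [interior_univ] at this
  exact monotoneOn_univ.1 this

theorem dPlus_mul_le (hf : ConvexOn ℝ univ f) (h : t ≤ u) : dPlus f t * (u - t) ≤ f u - f t := by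
  rcases h.eq_or_lt with rfl | h
  · simp
  · have := hf.rightDeriv_le_slope_of_mem_interior (x := t) (by simp) (mem_univ u) h
    rwa [slope_def_field, le_div_iff₀ (sub_pos.2 h)] at this

theorem sub_le_dPlus_mul (hf : ConvexOn ℝ univ f) (h : t ≤ u) :
    f u - f t ≤ dPlus f u * (u - t) := by
  rcases h.eq_or_lt with rfl | h
  · simp
  · have h1 := hf.slope_le_leftDeriv_of_mem_interior (mem_univ t) (y := u) (by simp) h
    have h2 := hf.leftDeriv_le_rightDeriv_of_mem_interior (x := u) (by simp)
    have h3 := h1.trans h2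
    rwa [slope_def_field, div_le_iff₀ (sub_pos.2 h)] at h3

theorem dPlus_pos_of_minimizers_eq {m : ℝ} (hf : ConvexOn ℝ univ f) (hm : minimizers f = {m})
    (h : m < t) : 0 < dPlus f t := by
  have h1 : ∀ v, f m ≤ f v := by
    have : m ∈ minimizers f := by simp [hm]
    exact this
  by_contra! h2
  have h3 := sub_le_dPlus_mul hf h.le
  have h4 : t ∈ minimizers f := fun v => by nlinarith [h1 v]
  rw [hm] at h4
  exact h.ne' h4

theorem dPlus_neg_of_minimizers_eq {m : ℝ} (hf : ConvexOn ℝ univ f) (hm : minimizers f = {m})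
    (h : t < m) : dPlus f t < 0 := by
  have h1 : ∀ v, f m ≤ f v := by
    have : m ∈ minimizers f := by simp [hm]
    exact this
  by_contra! h2
  have h3 := dPlus_mul_le hf h.le
  have h4 : t ∈ minimizers f := fun v => by nlinarith [h1 v]
  rw [hm] at h4
  exact h.ne h4

theorem lt_of_mem_minimizers (hf : ConvexOn ℝ univ f) (ht : dPlus f t < 0)
    (hu : u ∈ minimizers f) : t < u := by
  by_contra! h
  have h1 := (monotone_dPlus hf h).trans_lt ht
  have hd := hasDerivWithinAt_dPlus hf u
  have hge : 0 ≤ dPlus f u := by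
    refine ge_of_tendsto ((hasDerivWithinAt_iff_tendsto_slope' self_notMem_Ioi).1 hd) ?_
    filter_upwards [self_mem_nhdsWithin] with v hv
    rw [slope_def_field]
    exact div_nonneg (sub_nonneg.2 (hu v)) (sub_nonneg.2 (le_of_lt hv))
  linarith

theorem dPlus_nonneg_of_mem_minimizers (hf : ConvexOn ℝ univ f) (hu : t ∈ minimizers f) :
    0 ≤ dPlus f t := by
  by_contra! h
  exact lt_irrefl _ (lt_of_mem_minimizers hf h hu)

/-- Outside `[a, b]` the function exceeds its value at the nearer endpoint, so a minimum over the
compact interval is global. -/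
theorem minimizers_nonempty_bddBelow {a b : ℝ} (hf : ConvexOn ℝ univ f) (ha : dPlus f a < 0)
    (hb : 0 < dPlus f b) : (minimizers f).Nonempty ∧ BddBelow (minimizers f) := by
  refine ⟨?_, a, fun u hu => (lt_of_mem_minimizers hf ha hu).le⟩
  have hab : a < b := by
    by_contra! h
    linarith [monotone_dPlus hf h]
  have hcont : Continuous f := by
    rw [← continuousOn_univ]
    exact hf.continuousOn isOpen_univ
  obtain ⟨c, -, hc⟩ := isCompact_Icc.exists_isMinOn (nonempty_Icc.2 hab.le) hcont.continuousOn
  refine ⟨c, fun u => ?_⟩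
  rcases lt_or_ge u a with h | h
  · have h1 := sub_le_dPlus_mul hf h.le
    have h2 : f c ≤ f a := hc ⟨le_rfl, hab.le⟩
    nlinarith
  rcases lt_or_ge b u with h' | h'
  · have h1 := dPlus_mul_le hf h'.le
    have h2 : f c ≤ f b := hc ⟨hab.le, le_rfl⟩
    nlinarith
  exact hc ⟨h, h'⟩

/-- A nonnegative right derivative makes `f` nondecreasing to the right of `t`; if some minimizer
lies there, `t` is one too. -/
theorem smallestMinimizer_le (hf : ConvexOn ℝ univ f) (hne : (minimizers f).Nonempty)
    (hbdd : BddBelow (minimizers f)) (ht : 0 ≤ dPlus f t) : smallestMinimizer f ≤ t := by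
  obtain ⟨u, hu⟩ := hne
  rcases le_total u t with h | h
  · exact (csInf_le hbdd hu).trans h
  · refine csInf_le hbdd fun v => ?_
    have := dPlus_mul_le hf h
    nlinarith [hu v]

theorem dPlus_nonneg_of_smallestMinimizer_lt (hf : ConvexOn ℝ univ f)
    (hne : (minimizers f).Nonempty) (ht : smallestMinimizer f < t) : 0 ≤ dPlus f t := by
  obtain ⟨u, hu, hut⟩ := exists_lt_of_csInf_lt hne ht
  exact (dPlus_nonneg_of_mem_minimizers hf hu).trans (monotone_dPlus hf hut.le)

end Convex

/-! ### Differentiation of the criterion under the integral. -/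

section Criterion

variable {S : Type*} [MeasurableSpace S] {Q : Measure S} {h : S → ℝ → ℝ} {t₀ : ℝ}

theorem measurable_dPlus (hm : ∀ t, Measurable fun x => h x t)
    (hc : ∀ x, ConvexOn ℝ univ (h x)) (t : ℝ) : Measurable fun x => dPlus (h x) t := by
  refine measurable_of_tendsto_metrizable' (𝓝[>] t) (f := fun u x => slope (h x) t u)
    (fun u => ?_) (tendsto_pi_nhds.2 fun x =>
      (hasDerivWithinAt_iff_tendsto_slope' self_notMem_Ioi).1 (hasDerivWithinAt_dPlus (hc x) t))
  simp only [slope_def_field]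
  exact ((hm u).sub (hm t)).div_const _

theorem integrable_sub (hm : ∀ t, Measurable fun x => h x t)
    (hc : ∀ x, ConvexOn ℝ univ (h x)) (hi : ∀ t, Integrable (fun x => dPlus (h x) t) Q)
    (t u : ℝ) : Integrable (fun x => h x u - h x t) Q := by
  wlog htu : t ≤ u generalizing t u
  · exact (this u t (le_of_not_ge htu)).neg.congr (ae_of_all _ fun x => by simp)
  · refine (((hi t).norm.add (hi u).norm).mul_const (u - t)).mono'
      ((hm u).sub (hm t)).aestronglyMeasurable (ae_of_all _ fun x => ?_)
    have h1 := dPlus_mul_le (hc x) htu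
    have h2 := sub_le_dPlus_mul (hc x) htu
    have h3 : 0 ≤ u - t := sub_nonneg.2 htu
    simp only [Pi.add_apply, Real.norm_eq_abs]
    rw [abs_le]
    constructor
    · nlinarith [neg_abs_le (dPlus (h x) t), abs_nonneg (dPlus (h x) u)]
    · nlinarith [le_abs_self (dPlus (h x) u), abs_nonneg (dPlus (h x) t)]

theorem convexOn_criterion (hm : ∀ t, Measurable fun x => h x t)
    (hc : ∀ x, ConvexOn ℝ univ (h x)) (hi : ∀ t, Integrable (fun x => dPlus (h x) t) Q) :
    ConvexOn ℝ univ (criterion Q h t₀) := by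
  refine ⟨convex_univ, fun t _ u _ a b ha hb hab => ?_⟩
  have I := integrable_sub hm hc hi t₀
  simp only [criterion, smul_eq_mul]
  rw [← integral_const_mul, ← integral_const_mul, ← integral_add ((I t).const_mul a)
    ((I u).const_mul b)]
  refine integral_mono (I _) (((I t).const_mul a).add ((I u).const_mul b)) fun x => ?_
  have h1 := (hc x).2 (mem_univ t) (mem_univ u) ha hb hab
  simp only [smul_eq_mul] at h1
  have h2 : h x t₀ = a * h x t₀ + b * h x t₀ := by rw [← add_mul, hab, one_mul]
  simp only
  linarith

/-- Dominated convergence: for `u` in `(t, t + 1)` the slope lies between the right derivatives at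
`t` and `t + 1`. -/
theorem dPlus_criterion (hm : ∀ t, Measurable fun x => h x t)
    (hc : ∀ x, ConvexOn ℝ univ (h x)) (hi : ∀ t, Integrable (fun x => dPlus (h x) t) Q) (t : ℝ) :
    dPlus (criterion Q h t₀) t = ∫ x, dPlus (h x) t ∂Q := by
  refine dPlus_eq_of_hasDerivWithinAt ((hasDerivWithinAt_iff_tendsto_slope' self_notMem_Ioi).2 ?_)
  have I := integrable_sub hm hc hi
  have hslope : ∀ u, slope (criterion Q h t₀) t u = ∫ x, slope (h x) t u ∂Q := fun u => by
    simp only [slope_def_field, criterion]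
    rw [← integral_sub (I t₀ u) (I t₀ t), ← integral_div]
    simp
  rw [show slope (criterion Q h t₀) t = fun u => ∫ x, slope (h x) t u ∂Q from funext hslope]
  refine tendsto_integral_filter_of_dominated_convergence
    (fun x => ‖dPlus (h x) t‖ + ‖dPlus (h x) (t + 1)‖) ?_ ?_ ((hi t).norm.add (hi (t + 1)).norm)
    (ae_of_all _ fun x =>
      (hasDerivWithinAt_iff_tendsto_slope' self_notMem_Ioi).1 (hasDerivWithinAt_dPlus (hc x) t))
  · refine Eventually.of_forall fun u => ?_
    simp only [slope_def_field]
    exact ((I t u).div_const _).1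
  · filter_upwards [Ioo_mem_nhdsGT (lt_add_one t)] with u hu
    refine ae_of_all _ fun x => ?_
    have h3 : 0 < u - t := sub_pos.2 hu.1
    have h1 : dPlus (h x) t ≤ slope (h x) t u := by
      rw [slope_def_field, le_div_iff₀ h3]; exact dPlus_mul_le (hc x) hu.1.le
    have h2 : slope (h x) t u ≤ dPlus (h x) u := by
      rw [slope_def_field, div_le_iff₀ h3]; exact sub_le_dPlus_mul (hc x) hu.1.le
    have h4 := monotone_dPlus (hc x) hu.2.le
    simp only [Real.norm_eq_abs]
    rw [abs_le]
    constructor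
    · linarith [neg_abs_le (dPlus (h x) t), abs_nonneg (dPlus (h x) (t + 1))]
    · linarith [le_abs_self (dPlus (h x) (t + 1)), abs_nonneg (dPlus (h x) t)]

end Criterion

/-! ### The empirical criterion. -/

section EmpiricalCriterion

variable {Ω S : Type*} {h : S → ℝ → ℝ} {t₀ : ℝ} {X : ℕ → Ω → S}

theorem convexOn_empCriterion (hc : ∀ x, ConvexOn ℝ univ (h x)) (k : ℕ) (ω : Ω) :
    ConvexOn ℝ univ (empCriterion X h t₀ k ω) := by
  have h1 : ConvexOn ℝ univ fun t => ∑ i ∈ Finset.range k, (h (X i ω) t - h (X i ω) t₀) := by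
    induction k with
    | zero => simpa using convexOn_const (0 : ℝ) convex_univ
    | succ k ih =>
      simp only [Finset.sum_range_succ]
      exact ih.add ((hc _).sub (concaveOn_const _ convex_univ))
  exact h1.smul (c := (k : ℝ)⁻¹) (by positivity)

theorem dPlus_empCriterion (hc : ∀ x, ConvexOn ℝ univ (h x)) (k : ℕ) (ω : Ω) (t : ℝ) :
    dPlus (empCriterion X h t₀ k ω) t
      = (k : ℝ)⁻¹ * ∑ i ∈ Finset.range k, dPlus (h (X i ω)) t := by
  refine dPlus_eq_of_hasDerivWithinAt ?_
  unfold empCriterion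
  refine HasDerivWithinAt.const_mul _ (HasDerivWithinAt.fun_sum fun i _ => ?_)
  exact (hasDerivWithinAt_dPlus (hc (X i ω)) t).sub_const _

end EmpiricalCriterion

/-- An i.i.d. sample `X` from `Q` together with a convex, integrable criterion `h`. -/
structure ConvexSample {Ω S : Type*} [MeasurableSpace Ω] [MeasurableSpace S] (P : Measure Ω)
    (Q : Measure S) (h : S → ℝ → ℝ) (X : ℕ → Ω → S) : Prop where
  meas : ∀ t, Measurable fun x => h x t
  convex : ∀ x, ConvexOn ℝ univ (h x)
  integrable : ∀ t, Integrable (fun x => dPlus (h x) t) Q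
  meas_sample : ∀ i, Measurable (X i)
  indep : iIndepFun X P
  map_eq : ∀ i, P.map (X i) = Q

/-- The event that some empirical criterion function from the `n`-th on fails to have its
minimizers inside `(m - 1, m + 1]`, as witnessed by its right derivatives. -/
def unlocalized {Ω S : Type*} (h : S → ℝ → ℝ) (t₀ : ℝ) (X : ℕ → Ω → S) (m : ℝ) (n : ℕ) : Set Ω :=
  {ω | ∃ k, n ≤ k ∧ ¬(dPlus (empCriterion X h t₀ k ω) (m - 1) < 0 ∧
    0 < dPlus (empCriterion X h t₀ k ω) (m + 1))}

theorem lintegral_le_supMoment {Ω S : Type*} [MeasurableSpace Ω] {P : Measure Ω}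
    {h : S → ℝ → ℝ} {X : ℕ → Ω → S} {m x₀ s t : ℝ} (ht : |t - m| ≤ x₀) :
    ∫⁻ ω, ENNReal.ofReal (|dPlus (h (X 0 ω)) t| ^ s) ∂P ≤ supMoment P X h m x₀ s := by
  have := le_iSup₂ (f := fun y (_ : y ∈ Icc (-x₀) x₀) =>
    ∫⁻ ω, ENNReal.ofReal (|dPlus (h (X 0 ω)) (m + y)| ^ s) ∂P) (t - m) (abs_le.1 ht)
  simpa [supMoment] using this

/-! ### Localization and moment bounds for the sample. -/

namespace ConvexSample

variable {Ω S : Type*} [MeasurableSpace Ω] [MeasurableSpace S] {P : Measure Ω}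
  {Q : Measure S} {h : S → ℝ → ℝ} {X : ℕ → Ω → S} {t₀ m x₀ s t : ℝ}

theorem measurable_dPlus_sample (H : ConvexSample P Q h X) (t : ℝ) (i : ℕ) :
    Measurable fun ω => dPlus (h (X i ω)) t :=
  (measurable_dPlus H.meas H.convex t).comp (H.meas_sample i)

theorem integrable_dPlus_sample (H : ConvexSample P Q h X) (t : ℝ) (i : ℕ) :
    Integrable (fun ω => dPlus (h (X i ω)) t) P := by
  have := H.integrable t
  rw [← H.map_eq i] at this
  exact this.comp_measurable (H.meas_sample i)

theorem identDistrib_sample (H : ConvexSample P Q h X) (i : ℕ) : IdentDistrib (X i) (X 0) P P :=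
  ⟨(H.meas_sample i).aemeasurable, (H.meas_sample 0).aemeasurable, by rw [H.map_eq, H.map_eq]⟩

theorem integral_dPlus_sample (H : ConvexSample P Q h X) (t : ℝ) (i : ℕ) :
    ∫ ω, dPlus (h (X i ω)) t ∂P = dPlus (criterion Q h t₀) t := by
  rw [dPlus_criterion H.meas H.convex H.integrable, ← H.map_eq i,
    integral_map (H.meas_sample i).aemeasurable
      (measurable_dPlus H.meas H.convex t).aestronglyMeasurable]

theorem measurable_dPlus_empCriterion (H : ConvexSample P Q h X) (k : ℕ) (t : ℝ) :
    Measurable fun ω => dPlus (empCriterion X h t₀ k ω) t := by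
  simp only [dPlus_empCriterion H.convex]
  exact (Finset.measurable_fun_sum _ fun i _ => H.measurable_dPlus_sample t i).const_mul _

theorem tendsto_dPlus_empCriterion (H : ConvexSample P Q h X) (t : ℝ) :
    ∀ᵐ ω ∂P, Tendsto (fun k : ℕ => dPlus (empCriterion X h t₀ k ω) t) atTop
      (𝓝 (dPlus (criterion Q h t₀) t)) := by
  have hg := measurable_dPlus H.meas H.convex t
  have := strong_law_ae_real (fun i ω => dPlus (h (X i ω)) t) (H.integrable_dPlus_sample t 0)
    (fun i j hij => (H.indep.indepFun hij).comp hg hg)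
    (fun i => (H.identDistrib_sample i).comp hg)
  filter_upwards [this] with ω hω
  rw [← H.integral_dPlus_sample t 0]
  simpa only [dPlus_empCriterion H.convex, div_eq_inv_mul] using hω

/-- The events decrease in `n`, and the strong law at `m - 1` and `m + 1` makes their intersection
null. -/
theorem tendsto_measure_unlocalized [IsProbabilityMeasure P] (H : ConvexSample P Q h X)
    (hm : minimizers (criterion Q h t₀) = {m}) :
    Tendsto (fun n => P (unlocalized h t₀ X m n)) atTop (𝓝 0) := by
  have hconv := convexOn_criterion (t₀ := t₀) H.meas H.convex H.integrable
  have hnull : P (⋂ n, unlocalized h t₀ X m n) = 0 := by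
    rw [measure_eq_zero_iff_ae_notMem]
    filter_upwards [H.tendsto_dPlus_empCriterion (t₀ := t₀) (m - 1),
      H.tendsto_dPlus_empCriterion (t₀ := t₀) (m + 1)] with ω h1 h2 hω
    have h3 := (h1.eventually_lt_const (dPlus_neg_of_minimizers_eq hconv hm (sub_one_lt m))).and
      (h2.eventually_const_lt (dPlus_pos_of_minimizers_eq hconv hm (lt_add_one m)))
    obtain ⟨N, hN⟩ := eventually_atTop.1 h3
    obtain ⟨k, hk, hk'⟩ := mem_iInter.1 hω N
    exact hk' (hN k hk)
  rw [← hnull]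
  refine tendsto_measure_iInter_atTop (fun n => ?_) ?_ ⟨0, measure_ne_top _ _⟩
  · have : unlocalized h t₀ X m n = ⋃ k, ⋃ (_ : n ≤ k),
        {ω | dPlus (empCriterion X h t₀ k ω) (m - 1) < 0 ∧
          0 < dPlus (empCriterion X h t₀ k ω) (m + 1)}ᶜ := by
      ext ω; simp only [unlocalized, mem_ofPred_eq, mem_iUnion, mem_compl_iff, exists_prop]
    rw [this]
    refine (MeasurableSet.iUnion fun k => MeasurableSet.iUnion fun _ =>
      MeasurableSet.compl ?_).nullMeasurableSet
    exact (measurableSet_lt (H.measurable_dPlus_empCriterion k _) measurable_const).inter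
      (measurableSet_lt measurable_const (H.measurable_dPlus_empCriterion k _))
  · rintro n n' hn ω ⟨k, hk, hk'⟩
    exact ⟨k, hn.trans hk, hk'⟩

theorem minimizers_of_notMem_unlocalized (H : ConvexSample P Q h X) {ω : Ω} {n k : ℕ}
    (hω : ω ∉ unlocalized h t₀ X m n) (hk : n ≤ k) :
    (minimizers (empCriterion X h t₀ k ω)).Nonempty ∧
      BddBelow (minimizers (empCriterion X h t₀ k ω)) := by
  obtain ⟨h1, h2⟩ := not_not.1 fun h => hω ⟨k, hk, h⟩
  exact minimizers_nonempty_bddBelow (convexOn_empCriterion H.convex k ω) h1 h2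

theorem integrable_abs_dPlus_rpow (H : ConvexSample P Q h X)
    (hfin : supMoment P X h m x₀ s < ∞) (ht : |t - m| ≤ x₀) (i : ℕ) :
    Integrable (fun ω => |dPlus (h (X i ω)) t| ^ s) P := by
  have hg : Measurable fun x => |dPlus (h x) t| ^ s :=
    (measurable_dPlus H.meas H.convex t).abs.pow_const s
  refine ((H.identDistrib_sample i).comp hg).integrable_iff.2
    ⟨(hg.comp (H.meas_sample 0)).aestronglyMeasurable, ?_⟩
  simp only [Function.comp_def]
  rw [hasFiniteIntegral_iff_ofReal (ae_of_all _ fun _ => Real.rpow_nonneg (abs_nonneg _) _)]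
  exact (lintegral_le_supMoment ht).trans_lt hfin

theorem integral_abs_dPlus_rpow_le (H : ConvexSample P Q h X)
    (hfin : supMoment P X h m x₀ s < ∞) (ht : |t - m| ≤ x₀) (i : ℕ) :
    ∫ ω, |dPlus (h (X i ω)) t| ^ s ∂P ≤ (supMoment P X h m x₀ s).toReal := by
  have hg : Measurable fun x => |dPlus (h x) t| ^ s :=
    (measurable_dPlus H.meas H.convex t).abs.pow_const s
  refine ((H.identDistrib_sample i).comp hg).integral_eq.trans_le ?_
  refine (integral_eq_lintegral_of_nonneg_ae (ae_of_all _ fun ω => ?_)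
    (hg.comp (H.meas_sample 0)).aestronglyMeasurable).trans_le
    (ENNReal.toReal_mono hfin.ne (lintegral_le_supMoment ht))
  simp only [Function.comp_apply, Pi.zero_apply]
  positivity

theorem abs_dPlus_criterion_rpow_le [IsProbabilityMeasure P] (H : ConvexSample P Q h X)
    (hfin : supMoment P X h m x₀ s < ∞) (hs : 1 ≤ s)
    (ht : |t - m| ≤ x₀) :
    |dPlus (criterion Q h t₀) t| ^ s ≤ (supMoment P X h m x₀ s).toReal := by
  have hi := H.integrable_dPlus_sample t 0
  have h1 : (∫ ω, |dPlus (h (X 0 ω)) t| ∂P) ^ s ≤ ∫ ω, |dPlus (h (X 0 ω)) t| ^ s ∂P :=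
    (convexOn_rpow hs).map_integral_le
      (Real.continuous_rpow_const (by linarith)).continuousOn isClosed_Ici
      (ae_of_all _ fun ω => mem_Ici.2 (abs_nonneg _)) hi.abs (H.integrable_abs_dPlus_rpow hfin ht 0)
  refine le_trans ?_ (h1.trans (H.integral_abs_dPlus_rpow_le hfin ht 0))
  rw [← H.integral_dPlus_sample t 0]
  exact Real.rpow_le_rpow (abs_nonneg _) abs_integral_le_integral_abs (by linarith)

theorem measure_exists_le_abs_centred_sum_le [IsProbabilityMeasure P] (H : ConvexSample P Q h X)
    (hfin : supMoment P X h m x₀ s < ∞) (hs : 2 ≤ s) {C : ℝ} (hC1 : 1 ≤ C)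
    (hC : ∀ r : ℝ, 1 ≤ r → ∀ a b : ℝ,
      |a + b| ^ s ≤ |a| ^ s + s * (|a| ^ (s - 2) * a) * b + |a| ^ s / (2 * r)
        + C * r ^ (s / 2 - 1) * |b| ^ s)
    (ht : |t - m| ≤ x₀) {l : ℝ} (hl : 0 < l) {n : ℕ} (hn : 1 ≤ n) :
    P {ω | ∃ k, n ≤ k ∧ l * k ≤
        |∑ i ∈ Finset.range k, (dPlus (h (X i ω)) t - dPlus (criterion Q h t₀) t)|}
      ≤ ENNReal.ofReal (8 * C * 2 ^ s) * supMoment P X h m x₀ s *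
        ENNReal.ofReal (√n * l) ^ (-s) := by
  set D := dPlus (criterion Q h t₀) t with hD
  set L := supMoment P X h m x₀ s with hL
  have hn0 : (0 : ℝ) < n := by exact_mod_cast hn
  have hpt : ∀ i ω, |dPlus (h (X i ω)) t - D| ^ s
      ≤ 2 ^ s * (|dPlus (h (X i ω)) t| ^ s + |D| ^ s) := fun i ω => by
    have := abs_add_rpow_le_two_rpow_mul (by linarith : 0 ≤ s) (dPlus (h (X i ω)) t) (-D)
    rwa [abs_neg, ← sub_eq_add_neg] at this
  have hmeas : ∀ i, Measurable fun ω => dPlus (h (X i ω)) t - D := fun i =>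
    (H.measurable_dPlus_sample t i).sub_const D
  have hdom : ∀ i, Integrable (fun ω => 2 ^ s * (|dPlus (h (X i ω)) t| ^ s + |D| ^ s)) P :=
    fun i => ((H.integrable_abs_dPlus_rpow hfin ht i).add (integrable_const _)).const_mul _
  have hint : ∀ i, Integrable (fun ω => |dPlus (h (X i ω)) t - D| ^ s) P := fun i =>
    (hdom i).mono' ((hmeas i).abs.pow_const s).aestronglyMeasurable (ae_of_all _ fun ω => by
      rw [Real.norm_of_nonneg (by positivity)]; exact hpt i ω)
  -- Centring costs a factor `2 * 2 ^ s`, since by Jensen `|D| ^ s` is bounded by the same supremum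
  -- of moments.
  have hbound : ∀ i, ∫ ω, |dPlus (h (X i ω)) t - D| ^ s ∂P ≤ 2 ^ s * (2 * L.toReal) := by
    intro i
    refine (integral_mono (hint i) (hdom i) (hpt i)).trans ?_
    rw [integral_const_mul, integral_add (H.integrable_abs_dPlus_rpow hfin ht i)
      (integrable_const _)]
    refine mul_le_mul_of_nonneg_left ?_ (by positivity)
    simp only [integral_const, probReal_univ, one_smul]
    have h1 := H.integral_abs_dPlus_rpow_le hfin ht i
    have h2 := H.abs_dPlus_criterion_rpow_le (t₀ := t₀) hfin (by linarith) ht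
    linarith
  have hind : iIndepFun (fun i ω => dPlus (h (X i ω)) t - D) P :=
    H.indep.comp (fun _ x => dPlus (h x) t - D)
      fun _ => (measurable_dPlus H.meas H.convex t).sub_const D
  have hmean : ∀ i, ∫ ω, (dPlus (h (X i ω)) t - D) ∂P = 0 := fun i => by
    rw [integral_sub (H.integrable_dPlus_sample t i) (integrable_const _),
      H.integral_dPlus_sample (t₀ := t₀) t i]
    simp [hD]
  refine (measure_exists_le_abs_sum_le hs hC1 hC hmeas hind hint hmean hbound hl hn).trans_eq ?_
  have hpos : 0 < √(n : ℝ) * l := by positivity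
  rw [ENNReal.ofReal_rpow_of_pos hpos, ← ENNReal.ofReal_toReal hfin.ne,
    ← ENNReal.ofReal_mul (by positivity), ← ENNReal.ofReal_mul (by positivity)]
  congr 1
  rw [ENNReal.toReal_ofReal ENNReal.toReal_nonneg]
  ring

/-- `D⁺M(m + x₀) > 0` because `m` is the unique minimizer, and Jensen bounds its `s`-th power by the
supremum. -/
theorem supMoment_pos [IsProbabilityMeasure P] (H : ConvexSample P Q h X)
    (hfin : supMoment P X h m x₀ s < ∞) (hs : 1 ≤ s) (hx₀ : 0 < x₀)
    (hm : minimizers (criterion Q h t₀) = {m}) : 0 < supMoment P X h m x₀ s := by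
  have h1 := dPlus_pos_of_minimizers_eq (convexOn_criterion H.meas H.convex H.integrable) hm
    (lt_add_of_pos_right m hx₀)
  have h2 := H.abs_dPlus_criterion_rpow_le (t₀ := t₀) (t := m + x₀) hfin hs
    (by simp [abs_of_pos hx₀])
  exact (ENNReal.toReal_pos_iff.1 ((by positivity : (0 : ℝ) < _).trans_le h2)).1

theorem sum_dPlus_neg_of_lt_mEst (H : ConvexSample P Q h X) {ω : Ω} {n k : ℕ} (hn : 1 ≤ n)
    (hω : ω ∉ unlocalized h t₀ X m n) (hk : n ≤ k) (ht : t < mEst X h t₀ k ω) :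
    ∑ i ∈ Finset.range k, dPlus (h (X i ω)) t < 0 := by
  obtain ⟨hne, hbdd⟩ := H.minimizers_of_notMem_unlocalized hω hk
  have h1 : dPlus (empCriterion X h t₀ k ω) t < 0 := by
    by_contra! h1
    exact (smallestMinimizer_le (convexOn_empCriterion H.convex k ω) hne hbdd h1).not_gt ht
  rw [dPlus_empCriterion H.convex] at h1
  have hk0 : (0 : ℝ) < k := by exact_mod_cast hn.trans hk
  by_contra! h2
  have : 0 ≤ (k : ℝ)⁻¹ * ∑ i ∈ Finset.range k, dPlus (h (X i ω)) t := by positivity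
  linarith

theorem sum_dPlus_nonneg_of_mEst_lt (H : ConvexSample P Q h X) {ω : Ω} {n k : ℕ} (hn : 1 ≤ n)
    (hω : ω ∉ unlocalized h t₀ X m n) (hk : n ≤ k) (ht : mEst X h t₀ k ω < t) :
    0 ≤ ∑ i ∈ Finset.range k, dPlus (h (X i ω)) t := by
  obtain ⟨hne, -⟩ := H.minimizers_of_notMem_unlocalized hω hk
  have h1 := dPlus_nonneg_of_smallestMinimizer_lt (convexOn_empCriterion H.convex k ω) hne ht
  rw [dPlus_empCriterion H.convex] at h1
  have hk0 : (0 : ℝ) < k := by exact_mod_cast hn.trans hk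
  exact nonneg_of_mul_nonneg_right h1 (inv_pos.2 hk0)

end ConvexSample

/-! ### Extracting an index from extended real suprema and infima. -/

section ExtendedReals

variable {n : ℕ} {a x : ℝ} {f : ℕ → ℝ}

theorem exists_lt_of_lt_mul_iSup (ha : 0 < a)
    (h : (x : EReal) < (a : EReal) * ⨆ k ≥ n, (f k : EReal)) : ∃ k, n ≤ k ∧ x / a < f k := by
  by_contra! hcon
  refine h.not_ge ?_
  have h1 : ⨆ k ≥ n, (f k : EReal) ≤ ((x / a : ℝ) : EReal) :=
    iSup₂_le fun k hk => EReal.coe_le_coe_iff.2 (hcon k hk)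
  calc (a : EReal) * ⨆ k ≥ n, (f k : EReal) ≤ (a : EReal) * ((x / a : ℝ) : EReal) :=
        mul_le_mul_of_nonneg_left h1 (EReal.coe_nonneg.2 ha.le)
    _ = x := by rw [← EReal.coe_mul]; congr 1; field_simp

theorem exists_lt_of_mul_iInf_lt (ha : 0 < a)
    (h : (a : EReal) * ⨅ k ≥ n, (f k : EReal) < (x : EReal)) : ∃ k, n ≤ k ∧ f k < x / a := by
  by_contra! hcon
  refine h.not_ge ?_
  have h1 : ((x / a : ℝ) : EReal) ≤ ⨅ k ≥ n, (f k : EReal) :=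
    le_iInf₂ fun k hk => EReal.coe_le_coe_iff.2 (hcon k hk)
  calc (x : EReal) = (a : EReal) * ((x / a : ℝ) : EReal) := by
        rw [← EReal.coe_mul]; congr 1; field_simp
    _ ≤ (a : EReal) * ⨅ k ≥ n, (f k : EReal) :=
        mul_le_mul_of_nonneg_left h1 (EReal.coe_nonneg.2 ha.le)

end ExtendedReals

/-! ### Tail bounds for the estimators. -/

namespace ConvexSample

variable {Ω S : Type*} [MeasurableSpace Ω] [MeasurableSpace S] {P : Measure Ω}
  [IsProbabilityMeasure P] {Q : Measure S} {h : S → ℝ → ℝ} {X : ℕ → Ω → S} {t₀ m x₀ s t : ℝ}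
  {C : ℝ} {n : ℕ}

theorem measure_exists_lt_mEst_le (H : ConvexSample P Q h X)
    (hfin : supMoment P X h m x₀ s < ∞) (hs : 2 ≤ s) (hC1 : 1 ≤ C)
    (hC : ∀ r : ℝ, 1 ≤ r → ∀ a b : ℝ,
      |a + b| ^ s ≤ |a| ^ s + s * (|a| ^ (s - 2) * a) * b + |a| ^ s / (2 * r)
        + C * r ^ (s / 2 - 1) * |b| ^ s)
    (hm : minimizers (criterion Q h t₀) = {m}) (ht : |t - m| ≤ x₀) (hmt : m < t) (hn : 1 ≤ n) :
    P ({ω | ∃ k, n ≤ k ∧ t < mEst X h t₀ k ω} \ unlocalized h t₀ X m n)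
      ≤ ENNReal.ofReal (8 * C * 2 ^ s) * supMoment P X h m x₀ s *
        ENNReal.ofReal (√n * dPlus (criterion Q h t₀) t) ^ (-s) := by
  have hD := dPlus_pos_of_minimizers_eq (convexOn_criterion H.meas H.convex H.integrable) hm hmt
  refine (measure_mono ?_).trans
    (H.measure_exists_le_abs_centred_sum_le hfin hs hC1 hC ht hD hn (t₀ := t₀))
  rintro ω ⟨⟨k, hk, hlt⟩, hω⟩
  refine ⟨k, hk, le_trans ?_ (neg_le_abs _)⟩
  have := H.sum_dPlus_neg_of_lt_mEst hn hω hk hlt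
  simp only [Finset.sum_sub_distrib, Finset.sum_const, Finset.card_range, nsmul_eq_mul]
  linarith

theorem measure_exists_mEst_lt_le (H : ConvexSample P Q h X)
    (hfin : supMoment P X h m x₀ s < ∞) (hs : 2 ≤ s) (hC1 : 1 ≤ C)
    (hC : ∀ r : ℝ, 1 ≤ r → ∀ a b : ℝ,
      |a + b| ^ s ≤ |a| ^ s + s * (|a| ^ (s - 2) * a) * b + |a| ^ s / (2 * r)
        + C * r ^ (s / 2 - 1) * |b| ^ s)
    (hm : minimizers (criterion Q h t₀) = {m}) (ht : |t - m| ≤ x₀) (hmt : t < m) (hn : 1 ≤ n) :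
    P ({ω | ∃ k, n ≤ k ∧ mEst X h t₀ k ω < t} \ unlocalized h t₀ X m n)
      ≤ ENNReal.ofReal (8 * C * 2 ^ s) * supMoment P X h m x₀ s *
        ENNReal.ofReal (-(√n * dPlus (criterion Q h t₀) t)) ^ (-s) := by
  have hD := dPlus_neg_of_minimizers_eq (convexOn_criterion H.meas H.convex H.integrable) hm hmt
  rw [← mul_neg]
  refine (measure_mono ?_).trans
    (H.measure_exists_le_abs_centred_sum_le hfin hs hC1 hC ht (neg_pos.2 hD) hn (t₀ := t₀))
  rintro ω ⟨⟨k, hk, hlt⟩, hω⟩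
  refine ⟨k, hk, le_trans ?_ (le_abs_self _)⟩
  have := H.sum_dPlus_nonneg_of_mEst_lt hn hω hk hlt
  simp only [Finset.sum_sub_distrib, Finset.sum_const, Finset.card_range, nsmul_eq_mul]
  linarith

end ConvexSample

/-! ### Passage to the limit. -/

/-- Continuity of powers on `[0, ∞]` includes `0 ^ (-s) = ∞` and `∞ ^ (-s) = 0` when `s > 0`, so
degenerate limits `δ(x)` need no separate case. -/
theorem tendsto_ofReal_rpow_neg {r : ℕ → ℝ} {d : EReal} (s : ℝ)
    (hr : Tendsto (fun n => (r n : EReal)) atTop (𝓝 d)) :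
    Tendsto (fun n => ENNReal.ofReal (r n) ^ (-s)) atTop (𝓝 (d.toENNReal ^ (-s))) := by
  have h1 := (EReal.continuous_toENNReal.tendsto d).comp hr
  refine (ENNReal.continuous_rpow_const.tendsto _).comp (h1.congr fun n => ?_)
  simp

theorem mainTheorem10 (s : ℝ) (hs : 2 ≤ s) :
    ∃ B : ℝ≥0, 0 < B ∧
      ∀ (Ω : Type u) (S : Type v) [MeasurableSpace Ω] [MeasurableSpace S]
        (P : Measure Ω) [IsProbabilityMeasure P] (Q : Measure S) [IsProbabilityMeasure Q]
        (h : S → ℝ → ℝ) (t₀ : ℝ) (X : ℕ → Ω → S) (m x₀ : ℝ),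
        (∀ t, Measurable fun x => h x t) →
        (∀ x, ConvexOn ℝ univ (h x)) →
        (∀ t, Integrable (fun x => dPlus (h x) t) Q) →
        (∀ t, Integrable (fun x => dMinus (h x) t) Q) →
        (∀ i, Measurable (X i)) →
        iIndepFun X P →
        (∀ i, P.map (X i) = Q) →
        minimizers (criterion Q h t₀) = {m} →
        0 < x₀ →
        supMoment P X h m x₀ s < ∞ →
        ∃ K : ℝ≥0, 0 < K ∧ (K : ℝ≥0∞) = B * supMoment P X h m x₀ s ∧
          ∀ (a : ℕ → ℝ) (δ : ℝ → EReal), IsNormalizing (criterion Q h t₀) m a δ →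
            (∀ x : ℝ, 0 < x →
              limsup (fun n : ℕ => P {ω | (x : EReal) <
                (a n : EReal) * ⨆ k ≥ n, ((mEst X h t₀ k ω - m : ℝ) : EReal)}) atTop
              ≤ K * (δ x).toENNReal ^ (-s)) ∧
            (∀ x : ℝ, x < 0 →
              limsup (fun n : ℕ => P {ω |
                (a n : EReal) * ⨅ k ≥ n, ((mEst X h t₀ k ω - m : ℝ) : EReal) < (x : EReal)}) atTop
              ≤ K * (-δ x).toENNReal ^ (-s)) ∧
            (∀ x : ℝ, 0 < x →
              limsup (fun n : ℕ => P {ω | (x : EReal) <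
                (a n : EReal) * ⨆ k ≥ n, ((|mEst X h t₀ k ω - m| : ℝ) : EReal)}) atTop
              ≤ 2 * K * (min (δ x) (-δ (-x))).toENNReal ^ (-s)) := by
  obtain ⟨C, hC1, hC⟩ := exists_abs_add_rpow_le_of_one_le hs
  have hB : 0 < 8 * C * 2 ^ s := by positivity
  -- `4 * C` comes from the maximal inequality and `2 * 2 ^ s` from centring; `C` is fixed before
  -- any data, so it depends only on `s`.
  refine ⟨(8 * C * 2 ^ s).toNNReal, Real.toNNReal_pos.2 hB, ?_⟩
  intro Ω S _ _ P _ Q _ h t₀ X m x₀ hmeas hconv hint _ hX hind hmap hm hx₀ hfin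
  have H : ConvexSample P Q h X := ⟨hmeas, hconv, hint, hX, hind, hmap⟩
  set L := supMoment P X h m x₀ s with hLdef
  have hKtop : ENNReal.ofReal (8 * C * 2 ^ s) * L ≠ ∞ :=
    ENNReal.mul_ne_top ENNReal.ofReal_ne_top hfin.ne
  have hL0 : 0 < L := H.supMoment_pos hfin (by linarith) hx₀ hm
  have hKpos : 0 < ENNReal.ofReal (8 * C * 2 ^ s) * L :=
    ENNReal.mul_pos (ENNReal.ofReal_pos.2 hB).ne' hL0.ne'
  refine ⟨(ENNReal.ofReal (8 * C * 2 ^ s) * L).toNNReal,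
    ENNReal.toNNReal_pos hKpos.ne' hKtop, ENNReal.coe_toNNReal hKtop, ?_⟩
  rw [ENNReal.coe_toNNReal hKtop]
  set K := ENNReal.ofReal (8 * C * 2 ^ s) * L with hK
  intro a δ hδ
  have hunloc := H.tendsto_measure_unlocalized hm
  set M := criterion Q h t₀ with hM
  have hupper : ∀ x : ℝ, Tendsto (fun n : ℕ => K *
      ENNReal.ofReal (√n * dPlus M (m + x / a n)) ^ (-s)) atTop
      (𝓝 (K * (δ x).toENNReal ^ (-s))) := fun x =>
    ENNReal.Tendsto.const_mul (tendsto_ofReal_rpow_neg s (hδ.tendsto x)) (Or.inr hKtop)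
  have hlower : ∀ x : ℝ, Tendsto (fun n : ℕ => K *
      ENNReal.ofReal (-(√n * dPlus M (m + x / a n))) ^ (-s)) atTop
      (𝓝 (K * (-δ x).toENNReal ^ (-s))) := fun x => by
    refine ENNReal.Tendsto.const_mul (tendsto_ofReal_rpow_neg s ?_) (Or.inr hKtop)
    have := (continuous_neg.tendsto (δ x)).comp (hδ.tendsto x)
    exact this.congr fun n => by simp
  -- Since `a n → ∞`, the point `m + x / a n` eventually lies where the moment bound holds.
  have hev : ∀ x : ℝ, ∀ᶠ n : ℕ in atTop, 1 ≤ n ∧ 0 < a n ∧ |m + x / a n - m| ≤ x₀ := by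
    intro x
    filter_upwards [eventually_ge_atTop 1, hδ.tendsto_atTop.eventually_ge_atTop (|x| / x₀)]
      with n hn h1
    have ha := hδ.pos n hn
    refine ⟨hn, ha, ?_⟩
    rw [add_sub_cancel_left, abs_div, abs_of_pos ha, div_le_iff₀ ha]
    rw [div_le_iff₀ hx₀] at h1
    linarith
  -- Only monotonicity and subadditivity are used, so the events defined by the estimator need not
  -- be measurable.
  have cover : ∀ {A B E : Set Ω}, A ⊆ B → P A ≤ P E + P (B \ E) := fun {A B E} hAB =>
    (measure_mono (by intro ω hω; by_cases hE : ω ∈ E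
                      · exact Or.inl hE
                      · exact Or.inr ⟨hAB hω, hE⟩)).trans (measure_union_le E (B \ E))
  refine ⟨fun x hx => ?_, fun x hx => ?_, fun x hx => ?_⟩
  · refine (limsup_le_limsup ?_).trans_eq ((hunloc.add (hupper x)).limsup_eq.trans (zero_add _))
    filter_upwards [hev x] with n ⟨hn, ha, hxn⟩
    refine (cover (B := {ω | ∃ k, n ≤ k ∧ m + x / a n < mEst X h t₀ k ω}) fun ω hω => ?_).trans
      (add_le_add le_rfl (H.measure_exists_lt_mEst_le hfin hs hC1 hC hm hxn
        (lt_add_of_pos_right m (div_pos hx ha)) hn))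
    obtain ⟨k, hk, hlt⟩ := exists_lt_of_lt_mul_iSup ha hω
    exact ⟨k, hk, by linarith⟩
  · refine (limsup_le_limsup ?_).trans_eq ((hunloc.add (hlower x)).limsup_eq.trans (zero_add _))
    filter_upwards [hev x] with n ⟨hn, ha, hxn⟩
    refine (cover (B := {ω | ∃ k, n ≤ k ∧ mEst X h t₀ k ω < m + x / a n}) fun ω hω => ?_).trans
      (add_le_add le_rfl (H.measure_exists_mEst_lt_le hfin hs hC1 hC hm hxn
        (add_lt_of_neg_right m (div_neg_of_neg_of_pos hx ha)) hn))
    obtain ⟨k, hk, hlt⟩ := exists_lt_of_mul_iInf_lt ha hω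
    exact ⟨k, hk, by linarith⟩
  · have hlim := hunloc.add ((hupper x).add (hlower (-x)))
    refine ((limsup_le_limsup ?_).trans_eq (hlim.limsup_eq.trans (zero_add _))).trans ?_
    · filter_upwards [hev x, hev (-x)] with n ⟨hn, ha, hxn⟩ ⟨_, _, hxn'⟩
      refine (cover (B := {ω | ∃ k, n ≤ k ∧ m + x / a n < mEst X h t₀ k ω} ∪
        {ω | ∃ k, n ≤ k ∧ mEst X h t₀ k ω < m + -x / a n}) fun ω hω => ?_).trans
        (add_le_add le_rfl ?_)
      · obtain ⟨k, hk, hlt⟩ := exists_lt_of_lt_mul_iSup ha hω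
        rcases lt_abs.1 hlt with h1 | h1
        · exact Or.inl ⟨k, hk, by linarith⟩
        · exact Or.inr ⟨k, hk, by rw [neg_div]; linarith⟩
      · rw [union_sdiff_distrib]
        exact (measure_union_le _ _).trans (add_le_add
          (H.measure_exists_lt_mEst_le hfin hs hC1 hC hm hxn
            (lt_add_of_pos_right m (div_pos hx ha)) hn)
          (H.measure_exists_mEst_lt_le hfin hs hC1 hC hm hxn'
            (add_lt_of_neg_right m (div_neg_of_neg_of_pos (neg_lt_zero.2 hx) ha)) hn))
    -- Each one-sided bound is at most the bound with the minimum, because `y ^ (-s)` is antitone;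
    -- this gives the factor `2`.
    · have hanti : ∀ {d e : EReal}, d ≤ e → e.toENNReal ^ (-s) ≤ d.toENNReal ^ (-s) := by
        intro d e hde
        rw [ENNReal.rpow_neg, ENNReal.rpow_neg, ENNReal.inv_le_inv]
        exact ENNReal.rpow_le_rpow (EReal.toENNReal_le_toENNReal hde) (by linarith)
      rw [two_mul, add_mul]
      exact add_le_add (mul_le_mul_right (hanti (min_le_left _ _)) _)
        (mul_le_mul_right (hanti (min_le_right _ _)) _)
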